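/- Let $\mathbb{R}^-=(-\infty,0]$ and let $w\in C^1(\mathbb{R}^-;\mathbb{R})$ satisfy $w>0$, $w'/w$ bounded and $w(0)=1$. Put $L^2_w=L^2(\mathbb{R}^-,w(\xi)\,d\xi;\mathbb{R})$ and let $H_w=\mathbb{R}\times L^2_w$ be the product Hilbert space, with elements $\mathbf{x}=(x_0,x_1)$. A function $f\in L^2_{loc}(\mathbb{R}^-)$ has weak derivative $f'=g\in L^2_{loc}(\mathbb{R}^-)$ if $\int_{\mathbb{R}^-} f\varphi'\,d\xi=-\int_{\mathbb{R}^-} g\varphi\,d\xi$ for all $\varphi\in C^1_c((-\infty,0);\mathbb{R})$; such an $f$ has a locally absolutely continuous version on $\mathbb{R}^-$, and $f(0)$ denotes the value at $0$ of that version. Let $W^{1,2}_w$ be the space of such $f$ with $\int_{\mathbb{R}^-}(|f|^2+|f'|^2)\,w\,d\xi<\infty$. Let $\mathcal{A}$ be the unbounded operator on $H_w$ given by $$D(\mathcal{A})=\{\mathbf{x}\in H_w : x_1\in W^{1,2}_w,\ x_0=x_1(0)\},\qquad \mathcal{A}\mathbf{x}=(0,x_1').$$ Then $\mathcal{A}$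 is densely defined, and its adjoint $\mathcal{A}^*$ in $H_w$ has domain $$D(\mathcal{A}^*)=\{\mathbf{x}\in H_w : x_1\in W^{1,2}_w\}$$ and acts by $$\mathcal{A}^*\mathbf{x}=\Big(x_1(0),\ -x_1'-x_1\frac{w'}{w}\Big).$$ -/

import Mathlib

open MeasureTheory Set

noncomputable section

namespace WeightedDelay

/-- A weight on `ℝ⁻ = (-∞, 0]`: a strictly positive `C¹` function `w` with `w' / w` bounded,
normalised by `w 0 = 1`.  Only the values on `(-∞, 0]` matter. -/
structure Weight where
  toFun : ℝ → ℝ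
  contDiffOn : ContDiffOn ℝ 1 toFun (Iic 0)
  pos : ∀ ξ ≤ 0, 0 < toFun ξ
  bounded : ∃ K : ℝ, ∀ ξ ≤ 0, |derivWithin toFun (Iic 0) ξ / toFun ξ| ≤ K
  map_zero : toFun 0 = 1

namespace Weight

instance : CoeFun Weight (fun _ => ℝ → ℝ) := ⟨Weight.toFun⟩

/-- The derivative `w'` on `(-∞, 0]` (one-sided at `0`). -/
def deriv (w : Weight) (ξ : ℝ) : ℝ := derivWithin w (Iic 0) ξ

/-- The measure `w(ξ) dξ` on `(-∞, 0]`. -/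
def measure (w : Weight) : Measure ℝ :=
  (volume.restrict (Iic (0 : ℝ))).withDensity (fun ξ => ENNReal.ofReal (w ξ))

theorem measure_absolutelyContinuous (w : Weight) :
    w.measure ≪ volume.restrict (Iic (0 : ℝ)) :=
  withDensity_absolutelyContinuous _ _

theorem absolutelyContinuous_measure (w : Weight) :
    volume.restrict (Iic (0 : ℝ)) ≪ w.measure := by
  refine withDensity_absolutelyContinuous' ?_ ?_
  · exact (w.contDiffOn.continuousOn.aemeasurable measurableSet_Iic).ennreal_ofReal
  · filter_upwards [ae_restrict_mem measurableSet_Iic] with ξ hξ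
    simpa using w.pos ξ hξ

end Weight

/-- `L²_w = L²(ℝ⁻, w(ξ) dξ; ℝ)`. -/
abbrev L2w (w : Weight) : Type := Lp ℝ 2 w.measure

/-- `H_w = ℝ × L²_w` with the Hilbert product structure. -/
abbrev Hw (w : Weight) : Type := WithLp 2 (ℝ × L2w w)

/-- `f ∈ L²_loc(ℝ⁻)`: square integrability on every compact interval `[a, 0]`. -/
def MemL2loc (f : ℝ → ℝ) : Prop :=
  ∀ a : ℝ, MemLp f 2 (volume.restrict (Icc a 0))

/-- `f ∈ L²_loc(ℝ⁻)` admits `g ∈ L²_loc(ℝ⁻)` as weak derivative, tested against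
`C¹_c((-∞, 0))`. -/
structure HasWeakDeriv (f g : ℝ → ℝ) : Prop where
  left_mem : MemL2loc f
  right_mem : MemL2loc g
  integral_eq : ∀ φ : ℝ → ℝ, ContDiff ℝ 1 φ → HasCompactSupport φ → tsupport φ ⊆ Iio 0 →
    ∫ ξ in Iic (0 : ℝ), f ξ * _root_.deriv φ ξ = - ∫ ξ in Iic (0 : ℝ), g ξ * φ ξ

theorem MemL2loc.add {f g : ℝ → ℝ} (hf : MemL2loc f) (hg : MemL2loc g) :
    MemL2loc (f + g) := fun a => (hf a).add (hg a)

theorem MemL2loc.const_smul {f : ℝ → ℝ} (c : ℝ) (hf : MemL2loc f) :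
    MemL2loc (c • f) := fun a => (hf a).const_smul c

theorem MemL2loc.congr {f g : ℝ → ℝ} (hf : MemL2loc f)
    (h : f =ᵐ[volume.restrict (Iic (0 : ℝ))] g) : MemL2loc g := fun a =>
  (memLp_congr_ae (ae_restrict_of_ae_restrict_of_subset Icc_subset_Iic_self h)).1 (hf a)

theorem MemL2loc.integrableOn {f : ℝ → ℝ} (hf : MemL2loc f) (a : ℝ) :
    IntegrableOn f (Icc a 0) := (hf a).integrable (by norm_num)

theorem MemL2loc.integrable_mul {f φ : ℝ → ℝ} (hf : MemL2loc f) (hφ : Continuous φ)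
    (hc : HasCompactSupport φ) :
    IntegrableOn (fun ξ => f ξ * φ ξ) (Iic 0) := by
  obtain ⟨a, ha⟩ := hc.isCompact.bddBelow
  have h1 : IntegrableOn (fun ξ => f ξ * φ ξ) (Icc a 0) :=
    (hf.integrableOn a).mul_continuousOn hφ.continuousOn isCompact_Icc
  refine h1.of_forall_sdiff_eq_zero measurableSet_Iic ?_
  intro x hx
  have : φ x = 0 := by
    by_contra h
    exact hx.2 ⟨ha (subset_tsupport _ h), hx.1⟩
  simp [this]

theorem HasWeakDeriv.congr {f g f' g' : ℝ → ℝ} (h : HasWeakDeriv f g)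
    (hf : f =ᵐ[volume.restrict (Iic (0 : ℝ))] f') (hg : g =ᵐ[volume.restrict (Iic (0 : ℝ))] g') :
    HasWeakDeriv f' g' where
  left_mem := h.left_mem.congr hf
  right_mem := h.right_mem.congr hg
  integral_eq φ h1 h2 h3 := by
    have e1 : ∫ ξ in Iic (0 : ℝ), f' ξ * _root_.deriv φ ξ
        = ∫ ξ in Iic (0 : ℝ), f ξ * _root_.deriv φ ξ :=
      integral_congr_ae (hf.mono fun x hx => by simp [hx])
    have e2 : ∫ ξ in Iic (0 : ℝ), g' ξ * φ ξ = ∫ ξ in Iic (0 : ℝ), g ξ * φ ξ :=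
      integral_congr_ae (hg.mono fun x hx => by simp [hx])
    rw [e1, e2, h.integral_eq φ h1 h2 h3]

theorem HasWeakDeriv.zero : HasWeakDeriv (0 : ℝ → ℝ) (0 : ℝ → ℝ) where
  left_mem _ := MemLp.zero
  right_mem _ := MemLp.zero
  integral_eq φ _ _ _ := by simp

theorem HasWeakDeriv.add {f g f' g' : ℝ → ℝ} (h : HasWeakDeriv f g) (h' : HasWeakDeriv f' g') :
    HasWeakDeriv (f + f') (g + g') where
  left_mem := h.left_mem.add h'.left_mem
  right_mem := h.right_mem.add h'.right_mem
  integral_eq φ h1 h2 h3 := by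
    have hd : Continuous (_root_.deriv φ) := h1.continuous_deriv le_rfl
    simp only [Pi.add_apply, add_mul]
    rw [integral_add (h.left_mem.integrable_mul hd h2.deriv)
        (h'.left_mem.integrable_mul hd h2.deriv),
      integral_add (h.right_mem.integrable_mul h1.continuous h2)
        (h'.right_mem.integrable_mul h1.continuous h2),
      h.integral_eq φ h1 h2 h3, h'.integral_eq φ h1 h2 h3]
    ring

theorem HasWeakDeriv.const_smul {f g : ℝ → ℝ} (c : ℝ) (h : HasWeakDeriv f g) :
    HasWeakDeriv (c • f) (c • g) where
  left_mem := h.left_mem.const_smul c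
  right_mem := h.right_mem.const_smul c
  integral_eq φ h1 h2 h3 := by
    simp only [Pi.smul_apply, smul_eq_mul, mul_assoc]
    rw [integral_const_mul, integral_const_mul, h.integral_eq φ h1 h2 h3]
    ring

theorem HasWeakDeriv.unique {f g g' : ℝ → ℝ} (h : HasWeakDeriv f g) (h' : HasWeakDeriv f g') :
    g =ᵐ[volume.restrict (Iic (0 : ℝ))] g' := by
  have hloc : ∀ k : ℝ → ℝ, MemL2loc k → LocallyIntegrableOn k (Iio 0) := by
    intro k hk x hx
    refine ⟨Icc (x - 1) 0 ∩ Iio 0, ?_, (hk.integrableOn _).mono_set inter_subset_left⟩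
    refine Filter.inter_mem (mem_nhdsWithin_of_mem_nhds (Icc_mem_nhds (by linarith) hx))
      self_mem_nhdsWithin
  have key := IsOpen.ae_eq_zero_of_integral_contDiff_smul_eq_zero (μ := volume)
    (f := fun ξ => g ξ - g' ξ) (isOpen_Iio (a := (0 : ℝ)))
    ((hloc g h.right_mem).sub (hloc g' h'.right_mem)) (by
      intro φ h1 h2 h3
      have h1' : ContDiff ℝ 1 φ := h1.of_le (by exact_mod_cast le_top)
      have e : ∫ x, φ x • (g x - g' x) = ∫ x in Iic (0 : ℝ), (g x * φ x - g' x * φ x) := by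
        rw [← setIntegral_eq_integral_of_forall_compl_eq_zero (s := Iic (0 : ℝ))]
        · congr 1; ext x; simp only [smul_eq_mul]; ring
        · intro x hx
          have : φ x = 0 := by
            by_contra hne
            exact hx (mem_Iic.2 (le_of_lt (h3 (subset_tsupport _ hne))))
          simp [this]
      rw [e, integral_sub (h.right_mem.integrable_mul h1'.continuous h2)
        (h'.right_mem.integrable_mul h1'.continuous h2)]
      have a1 := h.integral_eq φ h1' h2 h3
      have a2 := h'.integral_eq φ h1' h2 h3
      linarith)
  rw [← Measure.restrict_congr_set Iio_ae_eq_Iic, Filter.EventuallyEq,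
    ae_restrict_iff' measurableSet_Iio]
  filter_upwards [key] with x hx hx0
  exact sub_eq_zero.1 (hx hx0)

/-- The weighted Sobolev space `W^{1,2}_w`, as a subspace of `L²_w`: the classes `f ∈ L²_w`
that lie in `L²_loc` and have a weak derivative in `L²_loc` which belongs to `L²_w`, i.e. for which
`∫ (|f|² + |f'|²) w` is finite. -/
def W12 (w : Weight) : Submodule ℝ (L2w w) where
  carrier := {f | ∃ g : L2w w, HasWeakDeriv f g}
  zero_mem' := by
    have h0 : (0 : ℝ → ℝ) =ᵐ[volume.restrict (Iic (0 : ℝ))] (0 : L2w w) :=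
      (w.absolutelyContinuous_measure.ae_eq (Lp.coeFn_zero ℝ 2 w.measure)).symm
    exact ⟨0, HasWeakDeriv.zero.congr h0 h0⟩
  add_mem' := by
    rintro f f' ⟨g, hg⟩ ⟨g', hg'⟩
    exact ⟨g + g', (hg.add hg').congr
      (w.absolutelyContinuous_measure.ae_eq (Lp.coeFn_add f f')).symm
      (w.absolutelyContinuous_measure.ae_eq (Lp.coeFn_add g g')).symm⟩
  smul_mem' := by
    rintro c f ⟨g, hg⟩
    exact ⟨c • g, (hg.const_smul c).congr
      (w.absolutelyContinuous_measure.ae_eq (Lp.coeFn_smul c f)).symm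
      (w.absolutelyContinuous_measure.ae_eq (Lp.coeFn_smul c g)).symm⟩

theorem HasWeakDeriv.unique_L2w {w : Weight} {f : ℝ → ℝ} {g g' : L2w w}
    (h : HasWeakDeriv f g) (h' : HasWeakDeriv f g') : g = g' :=
  Lp.ext (w.measure_absolutelyContinuous.ae_eq (h.unique h'))

/-- The weak derivative `f ↦ f'`, as a linear map `W^{1,2}_w → L²_w`. -/
def weakDeriv (w : Weight) : W12 w →ₗ[ℝ] L2w w where
  toFun f := Classical.choose f.2
  map_add' f f' := by
    refine (Classical.choose_spec (f + f').2).unique_L2w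
      (((Classical.choose_spec f.2).add (Classical.choose_spec f'.2)).congr ?_ ?_)
    · exact (w.absolutelyContinuous_measure.ae_eq (Lp.coeFn_add _ _)).symm
    · exact (w.absolutelyContinuous_measure.ae_eq (Lp.coeFn_add _ _)).symm
  map_smul' c f := by
    refine (Classical.choose_spec (c • f).2).unique_L2w
      (((Classical.choose_spec f.2).const_smul c).congr ?_ ?_)
    · exact (w.absolutelyContinuous_measure.ae_eq (Lp.coeFn_smul _ _)).symm
    · exact (w.absolutelyContinuous_measure.ae_eq (Lp.coeFn_smul _ _)).symm

theorem hasWeakDeriv_weakDeriv {w : Weight} (f : W12 w) :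
    HasWeakDeriv (f : L2w w) (weakDeriv w f) := Classical.choose_spec f.2

/-- `F` is a locally absolutely continuous version of the class `f` on `(-∞, 0]`. -/
structure IsACVersion {w : Weight} (f : L2w w) (F : ℝ → ℝ) : Prop where
  ae_eq : F =ᵐ[w.measure] f
  locallyAC : ∀ a ≤ 0, AbsolutelyContinuousOnInterval F a 0

/-- `f(0) = c`, where `f(0)` is the value at `0` of the locally absolutely continuous version
of `f`. -/
def HasValueAtZero {w : Weight} (f : L2w w) (c : ℝ) : Prop :=
  ∃ F : ℝ → ℝ, IsACVersion f F ∧ F 0 = c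

/-- The value at `0` does not depend on the version. -/
theorem HasValueAtZero.unique {w : Weight} {f : L2w w} {c d : ℝ}
    (hc : HasValueAtZero f c) (hd : HasValueAtZero f d) : c = d := by
  obtain ⟨F, hF, rfl⟩ := hc
  obtain ⟨G, hG, rfl⟩ := hd
  have hae : F =ᵐ[volume.restrict (Icc (-1 : ℝ) 0)] G :=
    ae_restrict_of_ae_restrict_of_subset Icc_subset_Iic_self
      (w.absolutelyContinuous_measure.ae_eq (hF.ae_eq.trans hG.ae_eq.symm))
  have hu : uIcc (-1 : ℝ) 0 = Icc (-1) 0 := uIcc_of_le (by norm_num)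
  have hFc := (hF.locallyAC (-1) (by norm_num)).continuousOn
  have hGc := (hG.locallyAC (-1) (by norm_num)).continuousOn
  rw [hu] at hFc hGc
  exact Measure.eqOn_Icc_of_ae_eq volume (by norm_num) hae hFc hGc (by norm_num)

/-- The operator `𝒜` on `H_w`: its domain is the set of `(x₀, x₁)` with `x₁ ∈ W^{1,2}_w` and
`x₀ = x₁(0)`, and `𝒜 (x₀, x₁) = (0, x₁')`. -/
def opA (w : Weight) : Hw w →ₗ.[ℝ] Hw w where
  domain :=
    { carrier := {x | x.snd ∈ W12 w ∧ HasValueAtZero x.snd x.fst}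
      zero_mem' := by
        refine ⟨(W12 w).zero_mem, fun _ => 0, ⟨(Lp.coeFn_zero ℝ 2 w.measure).symm, ?_⟩, rfl⟩
        intro a _
        exact (LipschitzWith.const (0 : ℝ)).lipschitzOnWith.absolutelyContinuousOnInterval
      add_mem' := by
        rintro x y ⟨hx, F, hF, hF0⟩ ⟨hy, G, hG, hG0⟩
        refine ⟨(W12 w).add_mem hx hy, F + G,
          ⟨(hF.ae_eq.add hG.ae_eq).trans (Lp.coeFn_add x.snd y.snd).symm, ?_⟩, ?_⟩
        · exact fun a ha => (hF.locallyAC a ha).add (hG.locallyAC a ha)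
        · simp [hF0, hG0]
      smul_mem' := by
        rintro c x ⟨hx, F, hF, hF0⟩
        refine ⟨(W12 w).smul_mem c hx, c • F,
          ⟨(hF.ae_eq.const_smul c).trans (Lp.coeFn_smul c x.snd).symm, ?_⟩, ?_⟩
        · exact fun a ha => (hF.locallyAC a ha).const_smul c
        · simp [hF0] }
  toFun :=
    { toFun := fun x => WithLp.toLp 2 (0, weakDeriv w ⟨(x : Hw w).snd, x.2.1⟩)
      map_add' := by
        intro x y
        rw [← WithLp.toLp_add, Prod.mk_add_mk, add_zero, ← map_add]
        rfl
      map_smul' := by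
        intro c x
        rw [RingHom.id_apply, ← WithLp.toLp_smul, Prod.smul_mk, smul_zero, ← map_smul]
        rfl }

end WeightedDelay

end

open WeightedDelay

noncomputable section

namespace WeightedDelay

/-! ### Locally square integrable functions -/

/-! For `x` in the domain of `𝒜`, with locally absolutely continuous versions `X`, `Y` of `x₁`,
`y₁`, integrating `(X Y w)'` over `(-∞, 0]` gives `∫ X' Y w = X(0) Y(0) + ∫ X (-Y' - Y w'/w) w`. The
boundary term at `0` uses `w(0) = 1`; the one at `-∞` vanishes because `X Y w` and its derivative
are integrable. Since `x₀ = X(0)`, the right side is the pairing of `x` with `(Y(0), -Y' - Y w'/w)`,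
which lies in `H_w` because `w'/w` is bounded. The component `y₀` never enters, as `𝒜 x` has first
component `0`. This is `inner_opA`.

Conversely, if `z` represents `x ↦ ⟨y, 𝒜 x⟩`, testing with `φ ∈ C¹_c((-∞, 0))` shows that `y₁ w` has
weak derivative `-z₁ w`; dividing by `w` puts `y₁` in `W^{1,2}_w` (`snd_mem_W12_of_inner_eq`).
Density of the domain makes the adjoint value unique.

Both halves rest on `HasWeakDeriv.exists_locallyAC`, which reduces weak derivatives to classical
a.e. ones. -/

theorem MemL2loc.locallyIntegrableOn {f : ℝ → ℝ} (hf : MemL2loc f) :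
    LocallyIntegrableOn f (Iio 0) := by
  intro x hx
  refine ⟨Icc (x - 1) 0 ∩ Iio 0, ?_, (hf.integrableOn _).mono_set inter_subset_left⟩
  exact Filter.inter_mem (mem_nhdsWithin_of_mem_nhds (Icc_mem_nhds (by linarith) hx))
    self_mem_nhdsWithin

theorem MemL2loc.of_continuousOn {f : ℝ → ℝ} (hf : ContinuousOn f (Iic 0)) : MemL2loc f := by
  intro a
  have hc : ContinuousOn f (Icc a 0) := hf.mono Icc_subset_Iic_self
  rw [memLp_two_iff_integrable_sq (hc.aestronglyMeasurable measurableSet_Icc)]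
  exact (hc.pow 2).integrableOn_Icc

theorem MemL2loc.mul_continuousOn {f g : ℝ → ℝ} (hf : MemL2loc f) (hg : ContinuousOn g (Iic 0)) :
    MemL2loc (fun ξ => f ξ * g ξ) := by
  intro a
  have hc : ContinuousOn g (Icc a 0) := hg.mono Icc_subset_Iic_self
  have hm := (hf a).aestronglyMeasurable.mul (hc.aestronglyMeasurable measurableSet_Icc)
  refine (memLp_two_iff_integrable_sq hm).2 ?_
  have h2 : IntegrableOn (fun ξ => f ξ ^ 2) (Icc a 0) :=
    (memLp_two_iff_integrable_sq (hf a).aestronglyMeasurable).1 (hf a)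
  refine (h2.mul_continuousOn (hc.pow 2) isCompact_Icc).congr ?_
  exact Filter.Eventually.of_forall fun x => by simp [mul_pow]

theorem MemL2loc.sub {f g : ℝ → ℝ} (hf : MemL2loc f) (hg : MemL2loc g) :
    MemL2loc (f - g) := fun a => (hf a).sub (hg a)

theorem MemL2loc.intervalIntegrable {f : ℝ → ℝ} (hf : MemL2loc f) {a : ℝ} (ha : a ≤ 0) :
    IntervalIntegrable f volume a 0 :=
  (intervalIntegrable_iff_integrableOn_Icc_of_le ha).2 (hf.integrableOn a)

/-- The fundamental lemma of the calculus of variations on `(-∞, 0)`. -/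
theorem MemL2loc.ae_eq_zero {f : ℝ → ℝ} (hf : MemL2loc f)
    (h : ∀ φ : ℝ → ℝ, ContDiff ℝ 1 φ → HasCompactSupport φ → tsupport φ ⊆ Iio 0 →
      ∫ ξ in Iic (0 : ℝ), f ξ * φ ξ = 0) :
    f =ᵐ[volume.restrict (Iic (0 : ℝ))] 0 := by
  have key := IsOpen.ae_eq_zero_of_integral_contDiff_smul_eq_zero (μ := volume) (f := f)
    (isOpen_Iio (a := (0 : ℝ))) hf.locallyIntegrableOn (by
      intro φ h1 h2 h3
      rw [← h φ (h1.of_le (by exact_mod_cast le_top)) h2 h3,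
        ← setIntegral_eq_integral_of_forall_compl_eq_zero (s := Iic (0 : ℝ))]
      · simp only [smul_eq_mul, mul_comm]
      · intro x hx
        have : φ x = 0 := by
          by_contra hne
          exact hx (mem_Iic.2 (le_of_lt (h3 (subset_tsupport _ hne))))
        simp [this])
  rw [← Measure.restrict_congr_set Iio_ae_eq_Iic, Filter.EventuallyEq,
    ae_restrict_iff' measurableSet_Iio]
  exact key

/-- A property that holds almost everywhere on each `[a, 0]` holds almost everywhere
on `(-∞, 0]`. -/
theorem ae_restrict_Iic_of_forall_Icc {p : ℝ → Prop}
    (h : ∀ a ≤ (0 : ℝ), ∀ᵐ x, x ∈ Icc a 0 → p x) : ∀ᵐ x ∂volume.restrict (Iic (0 : ℝ)), p x := by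
  rw [ae_restrict_iff' measurableSet_Iic]
  have h' : ∀ᵐ x, ∀ n : ℕ, x ∈ Icc (-(n : ℝ)) 0 → p x :=
    ae_all_iff.2 fun n => h _ (by simp)
  filter_upwards [h'] with x hx hx0
  obtain ⟨n, hn⟩ := exists_nat_ge (-x)
  exact hx n ⟨by linarith, hx0⟩

/-! ### Locally absolutely continuous functions -/

/-- `F` is absolutely continuous on every interval `[a, 0]`. -/
def LocallyAC (F : ℝ → ℝ) : Prop := ∀ a ≤ 0, AbsolutelyContinuousOnInterval F a 0

theorem LocallyAC.continuousOn {F : ℝ → ℝ} (hF : LocallyAC F) : ContinuousOn F (Iic 0) := by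
  intro x hx
  have h := (hF (x - 1) (by linarith [mem_Iic.1 hx])).continuousOn
  rw [uIcc_of_le (by linarith [mem_Iic.1 hx])] at h
  refine (h x ⟨by linarith, hx⟩).mono_of_mem_nhdsWithin ?_
  rw [← Ici_inter_Iic]
  exact Filter.inter_mem (mem_nhdsWithin_of_mem_nhds (Ici_mem_nhds (by linarith)))
    self_mem_nhdsWithin

theorem LocallyAC.mul {F G : ℝ → ℝ} (hF : LocallyAC F) (hG : LocallyAC G) :
    LocallyAC (fun ξ => F ξ * G ξ) := fun a ha => (hF a ha).fun_mul (hG a ha)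

theorem LocallyAC.ae_differentiableAt {F : ℝ → ℝ} (hF : LocallyAC F) :
    ∀ᵐ x ∂volume.restrict (Iic (0 : ℝ)), DifferentiableAt ℝ F x :=
  ae_restrict_Iic_of_forall_Icc fun a ha => by
    simpa only [uIcc_of_le ha] using (hF a ha).ae_differentiableAt

theorem _root_.ContDiffOn.locallyAC {F : ℝ → ℝ} (hF : ContDiffOn ℝ 1 F (Iic 0)) :
    LocallyAC F := fun a ha => by
  refine ContDiffOn.absolutelyContinuousOnInterval (hF.mono ?_)
  rw [uIcc_of_le ha]
  exact Icc_subset_Iic_self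

/-- The classical a.e. derivative of a locally absolutely continuous function is its weak
derivative. -/
theorem LocallyAC.hasWeakDeriv {F : ℝ → ℝ} (hF : LocallyAC F) (hF' : MemL2loc (deriv F)) :
    HasWeakDeriv F (deriv F) where
  left_mem := MemL2loc.of_continuousOn hF.continuousOn
  right_mem := hF'
  integral_eq φ h1 h2 h3 := by
    obtain ⟨b, hb⟩ := h2.isCompact.bddBelow
    -- With `a` strictly left of the support, `φ` vanishes at both ends of `[a, 0]`, so integration
    -- by parts there leaves no boundary terms.
    obtain ⟨a, ha0, hab⟩ : ∃ a : ℝ, a ≤ 0 ∧ a < b :=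
      ⟨min 0 (b - 1), min_le_left _ _, (min_le_right _ _).trans_lt (by linarith)⟩
    have hz : ∀ x ≤ a, x ∉ tsupport φ := fun x hx hxs => by linarith [hb hxs]
    have hφa : φ a = 0 := image_eq_zero_of_notMem_tsupport (hz a le_rfl)
    have hφ0 : φ 0 = 0 := image_eq_zero_of_notMem_tsupport fun h => lt_irrefl (0 : ℝ) (mem_Iio.1 (h3 h))
    have hint : ∀ k : ℝ → ℝ, (∀ x ≤ a, k x = 0) →
        ∫ x in Iic (0 : ℝ), k x = ∫ x in a..0, k x := by
      intro k hk
      rw [intervalIntegral.integral_of_le ha0]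
      refine setIntegral_eq_of_subset_of_forall_sdiff_eq_zero measurableSet_Iic
        Ioc_subset_Iic_self ?_
      intro x hx
      by_cases hxa : x ≤ a
      · exact hk x hxa
      · exact absurd ⟨not_le.1 hxa, hx.1⟩ hx.2
    have hφac : AbsolutelyContinuousOnInterval φ a 0 :=
      h1.contDiffOn.absolutelyContinuousOnInterval
    rw [hint _ fun x hx => by
        rw [image_eq_zero_of_notMem_tsupport fun h => hz x hx (tsupport_deriv_subset h), mul_zero],
      hint _ fun x hx => by rw [image_eq_zero_of_notMem_tsupport (hz x hx), mul_zero],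
      (hF a ha0).integral_mul_deriv_eq_deriv_mul hφac, hφa, hφ0]
    ring

/-- A continuous function with compact support in `(-∞, 0)` and mean zero has a primitive with
compact support in `(-∞, 0)`. -/
theorem exists_primitive_of_integral_eq_zero {ψ : ℝ → ℝ} (hψ : Continuous ψ)
    (hc : HasCompactSupport ψ) (hs : tsupport ψ ⊆ Iio 0) (h0 : ∫ x, ψ x = 0) :
    ∃ φ : ℝ → ℝ, ContDiff ℝ 1 φ ∧ HasCompactSupport φ ∧ tsupport φ ⊆ Iio 0 ∧ deriv φ = ψ := by
  -- The support is compact in an open half-line, so its maximum `b` is strictly negative. An empty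
  -- support gets the empty interval `[0, -1]`.
  obtain ⟨a, b, hb0, hab⟩ : ∃ a b : ℝ, b < 0 ∧ tsupport ψ ⊆ Icc a b := by
    rcases (tsupport ψ).eq_empty_or_nonempty with he | hne
    · exact ⟨0, -1, by norm_num, by simp [he]⟩
    · obtain ⟨b, hb⟩ := hc.isCompact.exists_isGreatest hne
      obtain ⟨a, ha⟩ := hc.isCompact.bddBelow
      exact ⟨a, b, hs hb.1, fun x hx => ⟨ha hx, hb.2 hx⟩⟩
  have hzero : ∀ x, x ∉ Icc a b → ψ x = 0 := fun x hx =>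
    image_eq_zero_of_notMem_tsupport fun h => hx (hab h)
  -- The base point is `a - 1`, not `a`: the support must lie in the half-open interval `(a - 1,
  -- x]`, and it may contain `a`.
  have hder : deriv (fun x => ∫ t in (a - 1)..x, ψ t) = ψ :=
    funext fun x => hψ.deriv_integral ψ _ x
  have hsupp : Function.support (fun x => ∫ t in (a - 1)..x, ψ t) ⊆ Icc a b := by
    intro x hx
    by_contra hxab
    refine hx ?_
    rcases lt_or_ge x a with hxa | hxa
    · refine intervalIntegral.integral_zero_ae (Filter.Eventually.of_forall fun t ht => ?_)
      refine hzero t fun h => ?_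
      rcases mem_uIoc.1 ht with h' | h' <;> linarith [h.1, h'.1, h'.2]
    · have hxb : b < x := by
        by_contra hcon
        exact hxab ⟨hxa, not_lt.1 hcon⟩
      change ∫ t in (a - 1)..x, ψ t = 0
      rw [intervalIntegral.integral_eq_integral_of_support_subset, h0]
      intro t ht
      have := hab (subset_tsupport _ ht)
      exact ⟨by linarith [this.1], by linarith [this.2]⟩
  have hts := closure_minimal hsupp isClosed_Icc
  refine ⟨fun x => ∫ t in (a - 1)..x, ψ t, ?_, ?_, ?_, hder⟩
  · rw [contDiff_one_iff_deriv, hder]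
    exact ⟨fun x => (hψ.integral_hasStrictDerivAt _ x).hasDerivAt.differentiableAt, hψ⟩
  · exact isCompact_Icc.of_isClosed_subset (isClosed_tsupport _) hts
  · exact fun x hx => (hts hx).2.trans_lt hb0

/-- A function whose weak derivative vanishes is almost everywhere constant. -/
theorem HasWeakDeriv.ae_eq_const {f : ℝ → ℝ} (h : HasWeakDeriv f 0) :
    ∃ c : ℝ, f =ᵐ[volume.restrict (Iic (0 : ℝ))] fun _ => c := by
  -- Centre `-2` and outer radius `1` keep the support in `[-3, -1]`, away from `0`.
  let B : ContDiffBump (-2 : ℝ) := ⟨1 / 2, 1, by norm_num, by norm_num⟩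
  set ρ : ℝ → ℝ := B.normed volume
  have hρ1 : ContDiff ℝ 1 ρ := B.contDiff_normed
  have hρc : HasCompactSupport ρ := B.hasCompactSupport_normed
  have hρs : tsupport ρ ⊆ Iio 0 := by
    rw [B.tsupport_normed_eq]
    intro x hx
    rw [Real.closedBall_eq_Icc] at hx
    have : x ≤ -2 + 1 := hx.2
    exact mem_Iio.2 (by linarith)
  have hρi : ∫ x, ρ x = 1 := B.integral_normed
  -- The constant is forced: test `f = c` against `ρ`, which has integral `1`.
  set c : ℝ := ∫ x in Iic (0 : ℝ), f x * ρ x with hc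
  have hcmem : MemL2loc (fun _ => c) := MemL2loc.of_continuousOn continuousOn_const
  have hzero : f - (fun _ => c) =ᵐ[volume.restrict (Iic (0 : ℝ))] 0 := by
    refine (h.left_mem.sub hcmem).ae_eq_zero fun ψ h1 h2 h3 => ?_
    have hall : ∀ φ : ℝ → ℝ, tsupport φ ⊆ Iio 0 → ∫ x in Iic (0 : ℝ), φ x = ∫ x, φ x := by
      intro φ hφ
      refine setIntegral_eq_integral_of_forall_compl_eq_zero fun x hx => ?_
      exact image_eq_zero_of_notMem_tsupport fun hxs =>
        hx (mem_Iic.2 (le_of_lt (mem_Iio.1 (hφ hxs))))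
    set m : ℝ := ∫ x, ψ x with hm
    have hψi : Integrable ψ := h1.continuous.integrable_of_hasCompactSupport h2
    have hρint : Integrable ρ := hρ1.continuous.integrable_of_hasCompactSupport hρc
    -- Subtracting `m ρ` makes the mean zero, so `ψ - m ρ = φ'` for an admissible `φ`. Hence `∫ f (ψ
    -- - m ρ) = 0`, that is, `∫ f ψ = m c`.
    obtain ⟨φ, hφ1, hφ2, hφ3, hφd⟩ := exists_primitive_of_integral_eq_zero
      (ψ := ψ + (-m) • ρ) (h1.continuous.add (hρ1.continuous.const_smul (-m)))
      (h2.add (hρc.smul_left (f := fun _ => -m)))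
      ((tsupport_add _ _).trans (union_subset h3
        ((closure_mono (Function.support_const_smul_subset _ _)).trans hρs))) (by
        simp only [Pi.add_apply, Pi.smul_apply, smul_eq_mul]
        rw [integral_add hψi (hρint.const_mul _), integral_const_mul, hρi]
        ring)
    have hw := h.integral_eq φ hφ1 hφ2 hφ3
    have i1 := h.left_mem.integrable_mul h1.continuous h2
    have i2 := h.left_mem.integrable_mul hρ1.continuous hρc
    simp only [hφd, Pi.add_apply, Pi.smul_apply, smul_eq_mul, Pi.zero_apply, zero_mul,
      integral_zero, neg_zero] at hw
    have e : ∀ x, f x * (ψ x + -m * ρ x) = f x * ψ x - m * (f x * ρ x) := fun x => by ring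
    simp only [e] at hw
    rw [integral_sub i1 (i2.const_mul m), integral_const_mul] at hw
    simp only [Pi.sub_apply, sub_mul]
    rw [integral_sub i1 (hcmem.integrable_mul h1.continuous h2), integral_const_mul, hall ψ h3]
    linarith
  exact ⟨c, hzero.mono fun x hx => sub_eq_zero.1 hx⟩

/-- A primitive of an `L²_loc` function is locally absolutely continuous. -/
theorem MemL2loc.locallyAC_integral {g : ℝ → ℝ} (hg : MemL2loc g) :
    LocallyAC (fun x => ∫ t in (0 : ℝ)..x, g t) := fun _ ha =>
  (hg.intervalIntegrable ha).absolutelyContinuousOnInterval_intervalIntegral right_mem_uIcc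

theorem MemL2loc.deriv_integral_ae_eq {g : ℝ → ℝ} (hg : MemL2loc g) :
    deriv (fun x => ∫ t in (0 : ℝ)..x, g t) =ᵐ[volume.restrict (Iic (0 : ℝ))] g := by
  refine ae_restrict_Iic_of_forall_Icc fun a ha => ?_
  filter_upwards [(hg.intervalIntegrable ha).ae_hasDerivAt_integral] with x hx hxa
  exact (hx (by rwa [uIcc_of_le ha]) 0 right_mem_uIcc).deriv

/-- A function with a weak derivative has a locally absolutely continuous version. -/
theorem HasWeakDeriv.exists_locallyAC {f g : ℝ → ℝ} (h : HasWeakDeriv f g) :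
    ∃ F : ℝ → ℝ, LocallyAC F ∧ F =ᵐ[volume.restrict (Iic (0 : ℝ))] f ∧
      deriv F =ᵐ[volume.restrict (Iic (0 : ℝ))] g := by
  set G : ℝ → ℝ := fun x => ∫ t in (0 : ℝ)..x, g t with hG
  have hGac : LocallyAC G := h.right_mem.locallyAC_integral
  have hGd : deriv G =ᵐ[volume.restrict (Iic (0 : ℝ))] g := h.right_mem.deriv_integral_ae_eq
  have hGw : HasWeakDeriv G g :=
    (hGac.hasWeakDeriv (h.right_mem.congr hGd.symm)).congr (Filter.EventuallyEq.refl _ _) hGd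
  -- `f` and the primitive `G` share the weak derivative `g`, so they differ by a constant.
  obtain ⟨c, hc⟩ := HasWeakDeriv.ae_eq_const (f := f + (-1 : ℝ) • G)
    ((h.add (hGw.const_smul (-1))).congr (Filter.EventuallyEq.refl _ _)
      (Filter.Eventually.of_forall fun x => by simp))
  refine ⟨fun x => G x + c, ?_, ?_, ?_⟩
  · intro a ha
    exact (hGac a ha).fun_add
      (LipschitzWith.const c).lipschitzOnWith.absolutelyContinuousOnInterval
  · filter_upwards [hc] with x hx
    simp only [Pi.add_apply, Pi.smul_apply, smul_eq_mul] at hx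
    linarith
  · rwa [deriv_add_const']

/-! ### The weight and the weighted measure -/

namespace Weight

variable (w : Weight)

theorem continuousOn : ContinuousOn w (Iic 0) := w.contDiffOn.continuousOn

theorem ne_zero {ξ : ℝ} (hξ : ξ ∈ Iic (0 : ℝ)) : w ξ ≠ 0 := (w.pos ξ hξ).ne'

theorem locallyAC : LocallyAC w := w.contDiffOn.locallyAC

theorem locallyAC_inv : LocallyAC (fun ξ => (w ξ)⁻¹) :=
  (w.contDiffOn.inv fun _ hξ => w.ne_zero hξ).locallyAC

theorem hasDerivAt {ξ : ℝ} (hξ : ξ < 0) : HasDerivAt w (w.deriv ξ) ξ :=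
  ((w.contDiffOn.differentiableOn one_ne_zero ξ hξ.le).hasDerivWithinAt).hasDerivAt
    (Iic_mem_nhds hξ)

theorem continuousOn_deriv : ContinuousOn w.deriv (Iic 0) :=
  w.contDiffOn.continuousOn_derivWithin (uniqueDiffOn_Iic 0) le_rfl

theorem aemeasurable_ofReal :
    AEMeasurable (fun ξ => ENNReal.ofReal (w ξ)) (volume.restrict (Iic (0 : ℝ))) :=
  (w.continuousOn.aemeasurable measurableSet_Iic).ennreal_ofReal

theorem integral_measure (f : ℝ → ℝ) :
    ∫ ξ, f ξ ∂w.measure = ∫ ξ in Iic (0 : ℝ), f ξ * w ξ := by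
  rw [measure, integral_withDensity_eq_integral_toReal_smul₀ w.aemeasurable_ofReal (by simp)]
  refine setIntegral_congr_fun measurableSet_Iic fun ξ hξ => ?_
  simp only [ENNReal.toReal_ofReal (w.pos ξ hξ).le, smul_eq_mul, mul_comm]

theorem integrable_measure_iff {f : ℝ → ℝ} :
    Integrable f w.measure ↔ IntegrableOn (fun ξ => f ξ * w ξ) (Iic 0) := by
  rw [measure, integrable_withDensity_iff_integrable_smul₀' w.aemeasurable_ofReal (by simp)]
  refine integrable_congr ?_
  filter_upwards [ae_restrict_mem measurableSet_Iic] with ξ hξ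
  simp only [ENNReal.toReal_ofReal (w.pos ξ hξ).le, smul_eq_mul, mul_comm]

theorem ae_measure_iff {p : ℝ → Prop} :
    (∀ᵐ ξ ∂w.measure, p ξ) ↔ ∀ᵐ ξ ∂volume.restrict (Iic (0 : ℝ)), p ξ :=
  ⟨fun h => w.absolutelyContinuous_measure.ae_le h, fun h => w.measure_absolutelyContinuous.ae_le h⟩

/-- Discards the endpoint `0`, where the two-sided derivative would depend on values to the right.
-/
theorem ae_lt_zero : ∀ᵐ ξ ∂volume.restrict (Iic (0 : ℝ)), ξ < 0 := by
  rw [← Measure.restrict_congr_set Iio_ae_eq_Iic]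
  exact ae_restrict_mem measurableSet_Iio

/-- On a compact `[a, 0]` the weight is continuous and positive, so `w⁻¹` is bounded there and the
weight can be divided out. -/
theorem memL2loc_of_memLp {f : ℝ → ℝ} (hf : MemLp f 2 w.measure) : MemL2loc f := by
  intro a
  have hac : volume.restrict (Icc a 0) ≪ w.measure :=
    (Measure.restrict_mono_set _ Icc_subset_Iic_self).absolutelyContinuous.trans
      w.absolutelyContinuous_measure
  rw [memLp_two_iff_integrable_sq (hf.aestronglyMeasurable.mono_ac hac)]
  have h2 : IntegrableOn (fun ξ => f ξ ^ 2 * w ξ) (Icc a 0) :=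
    ((w.integrable_measure_iff.1
      ((memLp_two_iff_integrable_sq hf.aestronglyMeasurable).1 hf))).mono_set Icc_subset_Iic_self
  have hinv : ContinuousOn (fun ξ => (w ξ)⁻¹) (Icc a 0) :=
    w.locallyAC_inv.continuousOn.mono Icc_subset_Iic_self
  refine (h2.mul_continuousOn hinv isCompact_Icc).congr_fun (fun ξ hξ => ?_) measurableSet_Icc
  exact mul_inv_cancel_right₀ (w.ne_zero hξ.2) _

theorem memL2loc (f : L2w w) : MemL2loc f := w.memL2loc_of_memLp (Lp.memLp f)

theorem memLp_of_hasCompactSupport {φ : ℝ → ℝ} (hφ : Continuous φ) (hc : HasCompactSupport φ) :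
    MemLp φ 2 w.measure := by
  rw [memLp_two_iff_integrable_sq hφ.aestronglyMeasurable, w.integrable_measure_iff]
  have hc2 : HasCompactSupport fun ξ => φ ξ ^ 2 :=
    hc.mono fun ξ hξ h0 => hξ (by simp [h0])
  have h := (MemL2loc.of_continuousOn w.continuousOn).integrable_mul (hφ.pow 2) hc2
  exact h.congr_fun (fun ξ _ => mul_comm _ _) measurableSet_Iic

theorem aestronglyMeasurable_logDeriv :
    AEStronglyMeasurable (fun ξ => w.deriv ξ / w ξ) w.measure :=
  ((w.continuousOn_deriv.div w.continuousOn fun _ hξ => w.ne_zero hξ).aestronglyMeasurable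
    measurableSet_Iic).mono_ac w.measure_absolutelyContinuous

/-- Boundedness of `w'/w` enters here; it keeps the term `y₁ w'/w` of the adjoint in `L²_w`. -/
theorem memLp_mul_logDeriv {f : ℝ → ℝ} (hf : MemLp f 2 w.measure) :
    MemLp (fun ξ => f ξ * (w.deriv ξ / w ξ)) 2 w.measure := by
  obtain ⟨K, hK⟩ := w.bounded
  refine hf.of_le_mul (c := K) (hf.aestronglyMeasurable.mul w.aestronglyMeasurable_logDeriv) ?_
  rw [ae_measure_iff]
  filter_upwards [ae_restrict_mem measurableSet_Iic] with ξ hξ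
  rw [norm_mul, mul_comm]
  exact mul_le_mul_of_nonneg_right (hK ξ hξ) (norm_nonneg _)

end Weight

/-- Fundamental theorem of calculus on `(-∞, 0]` for an integrable, locally absolutely continuous
function with integrable derivative. -/
theorem LocallyAC.integral_Iic_deriv {P : ℝ → ℝ} (hP : LocallyAC P)
    (hi : IntegrableOn P (Iic 0)) (hi' : IntegrableOn (deriv P) (Iic 0)) :
    ∫ ξ in Iic (0 : ℝ), deriv P ξ = P 0 := by
  have h1 := intervalIntegral_tendsto_integral_Iic 0 hi' Filter.tendsto_id
  have h2 : Filter.Tendsto (fun a => P 0 - ∫ ξ in a..0, deriv P ξ) Filter.atBot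
      (nhds (P 0 - ∫ ξ in Iic (0 : ℝ), deriv P ξ)) := tendsto_const_nhds.sub h1
  have h3 : Filter.Tendsto P Filter.atBot (nhds (P 0 - ∫ ξ in Iic (0 : ℝ), deriv P ξ)) := by
    refine h2.congr' ?_
    filter_upwards [Filter.eventually_le_atBot 0] with a ha
    rw [(hP a ha).integral_deriv_eq_sub]
    ring
  -- `P` has a limit at `-∞`. Being integrable on a half-line of infinite length, it can only have
  -- limit `0`.
  have h4 := IntegrableAtFilter.eq_zero_of_tendsto
    (⟨Iic 0, Filter.Iic_mem_atBot 0, hi⟩ : IntegrableAtFilter P Filter.atBot) (by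
      intro s hs
      obtain ⟨b, hb⟩ := Filter.mem_atBot_sets.1 hs
      refine top_le_iff.1 ?_
      rw [← Real.volume_Iic (a := b)]
      exact measure_mono hb) h3
  linarith

/-- Integration by parts in `L²_w`. -/
theorem integral_deriv_mul_measure (w : Weight) {X Y : ℝ → ℝ} (hX : LocallyAC X) (hY : LocallyAC Y)
    (hX2 : MemLp X 2 w.measure) (hY2 : MemLp Y 2 w.measure)
    (hX' : MemLp (deriv X) 2 w.measure) (hY' : MemLp (deriv Y) 2 w.measure) :
    ∫ ξ, deriv X ξ * Y ξ ∂w.measure =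
      X 0 * Y 0 + ∫ ξ, X ξ * (- deriv Y ξ - Y ξ * (w.deriv ξ / w ξ)) ∂w.measure := by
  set Z : ℝ → ℝ := fun ξ => - deriv Y ξ - Y ξ * (w.deriv ξ / w ξ) with hZ
  have hZ2 : MemLp Z 2 w.measure := hY'.neg.sub (w.memLp_mul_logDeriv hY2)
  have i1 : Integrable (fun ξ => deriv X ξ * Y ξ) w.measure := hX'.integrable_mul hY2
  have i2 : Integrable (fun ξ => X ξ * Z ξ) w.measure := hX2.integrable_mul hZ2
  -- The summand `-Y w'/w` of `Z` is chosen so that, after multiplication by `w`, it accounts for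
  -- the derivative falling on the weight.
  have hd : deriv (fun ξ => X ξ * Y ξ * w ξ) =ᵐ[volume.restrict (Iic (0 : ℝ))]
      fun ξ => (deriv X ξ * Y ξ - X ξ * Z ξ) * w ξ := by
    filter_upwards [hX.ae_differentiableAt, hY.ae_differentiableAt, Weight.ae_lt_zero]
      with ξ h1 h2 h3
    rw [((h1.hasDerivAt.fun_mul h2.hasDerivAt).fun_mul (w.hasDerivAt h3)).deriv, hZ]
    have := w.ne_zero (mem_Iic.2 h3.le)
    field_simp
    ring
  have hdi := w.integrable_measure_iff.1 (i1.sub i2)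
  have key := ((hX.mul hY).mul w.locallyAC).integral_Iic_deriv
    (w.integrable_measure_iff.1 (hX2.integrable_mul hY2)) (Integrable.congr hdi hd.symm)
  rw [integral_congr_ae hd, ← w.integral_measure, integral_sub i1 i2, w.map_zero, mul_one] at key
  linarith

/-! ### Elements of the weighted Sobolev space -/

theorem HasWeakDeriv.mem_W12 {w : Weight} {f g : L2w w} (h : HasWeakDeriv f g) : f ∈ W12 w :=
  ⟨g, h⟩

theorem HasWeakDeriv.weakDeriv_eq {w : Weight} {f g : L2w w} (h : HasWeakDeriv f g)
    (hf : f ∈ W12 w) : weakDeriv w ⟨f, hf⟩ = g :=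
  (hasWeakDeriv_weakDeriv ⟨f, hf⟩).unique_L2w h

/-- An element of `W^{1,2}_w` has a locally absolutely continuous version, whose derivative is the
weak derivative. -/
theorem exists_isACVersion {w : Weight} (f : W12 w) :
    ∃ F : ℝ → ℝ, IsACVersion (f : L2w w) F ∧ deriv F =ᵐ[w.measure] weakDeriv w f := by
  obtain ⟨F, h1, h2, h3⟩ := (hasWeakDeriv_weakDeriv f).exists_locallyAC
  exact ⟨F, ⟨w.ae_measure_iff.2 h2, h1⟩, w.ae_measure_iff.2 h3⟩

/-- Continuous functions that agree a.e. agree on the open half-line, hence so do their derivatives.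
Any version therefore inherits the property of the constructed one. -/
theorem IsACVersion.deriv_ae_eq {w : Weight} {f : W12 w} {F : ℝ → ℝ}
    (hF : IsACVersion (f : L2w w) F) : deriv F =ᵐ[w.measure] weakDeriv w f := by
  obtain ⟨G, hG, hG'⟩ := exists_isACVersion f
  have hFc : ContinuousOn F (Iic 0) := LocallyAC.continuousOn hF.locallyAC
  have hGc : ContinuousOn G (Iic 0) := LocallyAC.continuousOn hG.locallyAC
  have heq : EqOn F G (Iio 0) := by
    refine Measure.eqOn_of_ae_eq (μ := volume) ?_ (hFc.mono Iio_subset_Iic_self)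
      (hGc.mono Iio_subset_Iic_self) (by rw [isOpen_Iio.interior_eq]; exact subset_closure)
    rw [Measure.restrict_congr_set Iio_ae_eq_Iic]
    exact w.ae_measure_iff.1 (hF.ae_eq.trans hG.ae_eq.symm)
  refine Filter.EventuallyEq.trans (w.ae_measure_iff.2 ?_) hG'
  filter_upwards [Weight.ae_lt_zero] with ξ hξ
  exact Filter.EventuallyEq.deriv_eq (heq.eventuallyEq_of_mem (Iio_mem_nhds hξ))

/-- A locally absolutely continuous version with derivative in `L²_w` gives an element of
`W^{1,2}_w`. -/
theorem IsACVersion.hasWeakDeriv {w : Weight} {f g : L2w w} {F : ℝ → ℝ} (hF : IsACVersion f F)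
    (hg : deriv F =ᵐ[w.measure] g) : HasWeakDeriv f g := by
  have hF' : LocallyAC F := hF.locallyAC
  have hg' := w.ae_measure_iff.1 hg
  exact (hF'.hasWeakDeriv ((w.memL2loc g).congr (Filter.EventuallyEq.symm hg'))).congr
    (w.ae_measure_iff.1 hF.ae_eq) hg'

/-! ### The operator and its adjoint -/

theorem inner_Hw {w : Weight} (x y : Hw w) :
    inner ℝ x y = x.fst * y.fst + ∫ ξ, x.snd ξ * y.snd ξ ∂w.measure := by
  rw [WithLp.prod_inner_apply, L2.inner_def]
  simp only [RCLike.inner_apply, conj_trivial, mul_comm]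
  rfl

/-- A compactly supported `C¹` function `φ` gives the element `(φ(0), φ)` of the domain of `𝒜`. -/
theorem exists_mem_domain (w : Weight) {φ : ℝ → ℝ} (h1 : ContDiff ℝ 1 φ)
    (h2 : HasCompactSupport φ) :
    ∃ x : (opA w).domain, (x : Hw w).fst = φ 0 ∧ (x : Hw w).snd =ᵐ[w.measure] φ ∧
      (opA w x).snd =ᵐ[w.measure] deriv φ := by
  have m1 : MemLp φ 2 w.measure := w.memLp_of_hasCompactSupport h1.continuous h2
  have m2 : MemLp (deriv φ) 2 w.measure :=
    w.memLp_of_hasCompactSupport (h1.continuous_deriv le_rfl) h2.deriv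
  have hv : IsACVersion (m1.toLp φ) φ := ⟨m1.coeFn_toLp.symm, h1.contDiffOn.locallyAC⟩
  have hw : HasWeakDeriv (m1.toLp φ) (m2.toLp (deriv φ)) := hv.hasWeakDeriv m2.coeFn_toLp.symm
  refine ⟨⟨WithLp.toLp 2 (φ 0, m1.toLp φ), hw.mem_W12, φ, hv, rfl⟩, rfl, m1.coeFn_toLp, ?_⟩
  have e : (opA w ⟨WithLp.toLp 2 (φ 0, m1.toLp φ), hw.mem_W12, φ, hv, rfl⟩).snd =
      m2.toLp (deriv φ) := hw.weakDeriv_eq hw.mem_W12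
  rw [e]
  exact m2.coeFn_toLp

/-- A vector orthogonal to the domain is tested with the elements `(φ(0), φ)`. Those with `φ`
supported in `(-∞, 0)` force `y₁ = 0`; one with `φ(0) = 1` then forces `y₀ = 0`. -/
theorem dense_domain_opA (w : Weight) : Dense ((opA w).domain : Set (Hw w)) := by
  rw [Submodule.dense_iff_topologicalClosure_eq_top, Submodule.topologicalClosure_eq_top_iff,
    Submodule.eq_bot_iff]
  intro y hy
  have hy' : ∀ φ : ℝ → ℝ, ContDiff ℝ 1 φ → HasCompactSupport φ →
      φ 0 * y.fst + ∫ ξ, φ ξ * y.snd ξ ∂w.measure = 0 := by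
    intro φ h1 h2
    obtain ⟨x, hx1, hx2, -⟩ := exists_mem_domain w h1 h2
    have h := (Submodule.mem_orthogonal _ _).1 hy x x.2
    rwa [inner_Hw, hx1, integral_congr_ae (g := fun ξ => φ ξ * y.snd ξ)
      (hx2.mono fun ξ hξ => by simp only [hξ])] at h
  have hsnd : y.snd = 0 := by
    have hz : (fun ξ => y.snd ξ * w ξ) =ᵐ[volume.restrict (Iic (0 : ℝ))] 0 := by
      refine ((w.memL2loc y.snd).mul_continuousOn w.continuousOn).ae_eq_zero fun φ h1 h2 h3 => ?_
      have h := hy' φ h1 h2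
      rw [image_eq_zero_of_notMem_tsupport fun h0 => lt_irrefl (0 : ℝ) (mem_Iio.1 (h3 h0)),
        zero_mul, zero_add, w.integral_measure] at h
      refine Eq.trans (integral_congr_ae (Filter.Eventually.of_forall fun ξ => ?_)) h
      ring
    refine (Lp.eq_zero_iff_ae_eq_zero).2 (w.ae_measure_iff.2 ?_)
    filter_upwards [hz, ae_restrict_mem measurableSet_Iic] with ξ h1 h2
    exact (mul_eq_zero.1 h1).resolve_right (w.ne_zero h2)
  have hfst : y.fst = 0 := by
    let B : ContDiffBump (0 : ℝ) := ⟨1, 2, by norm_num, by norm_num⟩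
    have h := hy' B B.contDiff B.hasCompactSupport
    have hB : B 0 = 1 := B.one_of_mem_closedBall (by simp [B])
    have hi : ∫ ξ, B ξ * y.snd ξ ∂w.measure = 0 := by
      rw [hsnd]
      refine integral_eq_zero_of_ae ((Lp.coeFn_zero ℝ 2 w.measure).mono fun ξ hξ => ?_)
      change B ξ * (0 : L2w w) ξ = 0
      rw [hξ, Pi.zero_apply, mul_zero]
    rwa [hB, one_mul, hi, add_zero] at h
  exact WithLp.ofLp_injective 2 (Prod.ext hfst hsnd)

/-- Green's formula: `⟨𝒜 x, y⟩ = x₀ y₁(0) + ∫ x₁ (-y₁' - y₁ w'/w) w`. -/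
theorem inner_opA {w : Weight} (x : (opA w).domain) {y z : Hw w} (hy : y.snd ∈ W12 w)
    (hz0 : HasValueAtZero y.snd z.fst)
    (hz : z.snd =ᵐ[w.measure]
      fun ξ => - weakDeriv w ⟨y.snd, hy⟩ ξ - y.snd ξ * (w.deriv ξ / w ξ)) :
    inner ℝ z (x : Hw w) = inner ℝ y (opA w x) := by
  obtain ⟨Y, hY, hY0⟩ := hz0
  obtain ⟨hx, X, hX, hX0⟩ := x.2
  have dX := IsACVersion.deriv_ae_eq (f := ⟨(x : Hw w).snd, hx⟩) hX
  have dY := IsACVersion.deriv_ae_eq (f := ⟨y.snd, hy⟩) hY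
  have key := integral_deriv_mul_measure w hX.locallyAC hY.locallyAC
    ((memLp_congr_ae hX.ae_eq).2 (Lp.memLp _)) ((memLp_congr_ae hY.ae_eq).2 (Lp.memLp _))
    ((memLp_congr_ae dX).2 (Lp.memLp _)) ((memLp_congr_ae dY).2 (Lp.memLp _))
  have e0 : (opA w x).fst = 0 := rfl
  have e1 : (opA w x).snd = weakDeriv w ⟨(x : Hw w).snd, hx⟩ := rfl
  rw [inner_Hw, inner_Hw, e0, e1, mul_zero, zero_add, ← hX0, ← hY0]
  have i1 : ∫ ξ, y.snd ξ * weakDeriv w ⟨(x : Hw w).snd, hx⟩ ξ ∂w.measure =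
      ∫ ξ, deriv X ξ * Y ξ ∂w.measure := by
    refine integral_congr_ae ?_
    filter_upwards [dX, hY.ae_eq] with ξ h1 h2
    rw [h1, h2, mul_comm]
  have i2 : ∫ ξ, z.snd ξ * (x : Hw w).snd ξ ∂w.measure =
      ∫ ξ, X ξ * (- deriv Y ξ - Y ξ * (w.deriv ξ / w ξ)) ∂w.measure := by
    refine integral_congr_ae ?_
    filter_upwards [dY, hY.ae_eq, hX.ae_eq, hz] with ξ h1 h2 h3 h4
    rw [h1, h2, h3, h4, mul_comm]
  rw [i1, i2, key, mul_comm]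

/-- The value of the adjoint predicted by Green's formula exists in `H_w`. -/
theorem exists_adjoint_value {w : Weight} {y : Hw w} (hy : y.snd ∈ W12 w) :
    ∃ z : Hw w, HasValueAtZero y.snd z.fst ∧ z.snd =ᵐ[w.measure]
      fun ξ => - weakDeriv w ⟨y.snd, hy⟩ ξ - y.snd ξ * (w.deriv ξ / w ξ) := by
  obtain ⟨Y, hY, -⟩ := exists_isACVersion ⟨y.snd, hy⟩
  have hm : MemLp (fun ξ => - weakDeriv w ⟨y.snd, hy⟩ ξ - y.snd ξ * (w.deriv ξ / w ξ)) 2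
      w.measure := (Lp.memLp _).neg.sub (w.memLp_mul_logDeriv (Lp.memLp y.snd))
  exact ⟨WithLp.toLp 2 (Y 0, hm.toLp _), ⟨Y, hY, rfl⟩, hm.coeFn_toLp⟩

/-- If `x ↦ ⟨y, 𝒜 x⟩` is represented by an element of `H_w`, then `y₁ ∈ W^{1,2}_w`. -/
theorem snd_mem_W12_of_inner_eq {w : Weight} {y z : Hw w}
    (h : ∀ x : (opA w).domain, inner ℝ z (x : Hw w) = inner ℝ y (opA w x)) : y.snd ∈ W12 w := by
  -- Test functions supported in `(-∞, 0)` vanish at `0`, so `z₀` drops out and only the second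
  -- components remain.
  have hU : HasWeakDeriv (fun ξ => y.snd ξ * w ξ) (fun ξ => - z.snd ξ * w ξ) := by
    refine ⟨(w.memL2loc y.snd).mul_continuousOn w.continuousOn,
      MemL2loc.mul_continuousOn (fun a => (w.memL2loc z.snd a).neg) w.continuousOn,
      fun φ h1 h2 h3 => ?_⟩
    obtain ⟨x, hx1, hx2, hx3⟩ := exists_mem_domain w h1 h2
    have hx := h x
    have e0 : (opA w x).fst = 0 := rfl
    rw [inner_Hw, inner_Hw, e0, hx1,
      image_eq_zero_of_notMem_tsupport fun h0 => lt_irrefl (0 : ℝ) (mem_Iio.1 (h3 h0)),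
      mul_zero, mul_zero, zero_add, zero_add, w.integral_measure, w.integral_measure] at hx
    have e1 : ∫ ξ in Iic (0 : ℝ), y.snd ξ * w ξ * deriv φ ξ =
        ∫ ξ in Iic (0 : ℝ), y.snd ξ * (opA w x).snd ξ * w ξ := by
      refine integral_congr_ae ((w.ae_measure_iff.1 hx3).mono fun ξ hξ => ?_)
      simp only [hξ]
      ring
    have e2 : ∫ ξ in Iic (0 : ℝ), - z.snd ξ * w ξ * φ ξ =
        - ∫ ξ in Iic (0 : ℝ), z.snd ξ * (x : Hw w).snd ξ * w ξ := by
      rw [← integral_neg]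
      refine integral_congr_ae ((w.ae_measure_iff.1 hx2).mono fun ξ hξ => ?_)
      simp only [hξ]
      ring
    rw [e1, e2, hx, neg_neg]
  obtain ⟨U, hUac, hUe, hUd⟩ := hU.exists_locallyAC
  have hm : MemLp (fun ξ => - z.snd ξ - y.snd ξ * (w.deriv ξ / w ξ)) 2 w.measure :=
    (Lp.memLp z.snd).neg.sub (w.memLp_mul_logDeriv (Lp.memLp y.snd))
  -- Dividing the version `U` of `y₁ w` by `w` gives a version of `y₁`, whose derivative by the
  -- product rule is `-z₁ - y₁ w'/w`, a member of `L²_w`.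
  have hv : IsACVersion y.snd (fun ξ => U ξ * (w ξ)⁻¹) := by
    refine ⟨w.ae_measure_iff.2 ?_, hUac.mul w.locallyAC_inv⟩
    filter_upwards [hUe, ae_restrict_mem measurableSet_Iic] with ξ h1 h2
    rw [h1, mul_inv_cancel_right₀ (w.ne_zero h2)]
  refine (hv.hasWeakDeriv (g := hm.toLp _) (Filter.EventuallyEq.trans
    (w.ae_measure_iff.2 ?_) hm.coeFn_toLp.symm)).mem_W12
  filter_upwards [hUe, hUd, hUac.ae_differentiableAt, Weight.ae_lt_zero] with ξ h1 h2 h3 h4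
  have hne := w.ne_zero (mem_Iic.2 h4.le)
  rw [(h3.hasDerivAt.fun_mul ((w.hasDerivAt h4).fun_inv hne)).deriv, h1, h2]
  field_simp
  ring

end WeightedDelay

end

open WeightedDelay

theorem mainTheorem8 (w : Weight) :
    Dense ((opA w).domain : Set (Hw w)) ∧
    ((opA w).adjoint.domain : Set (Hw w)) = {x | x.snd ∈ W12 w} ∧
    ∀ (x : (opA w).adjoint.domain) (hx : (x : Hw w).snd ∈ W12 w),
      HasValueAtZero (x : Hw w).snd ((opA w).adjoint x).fst ∧
      ((opA w).adjoint x).snd =ᵐ[w.measure]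
        fun ξ => - weakDeriv w ⟨(x : Hw w).snd, hx⟩ ξ - (x : Hw w).snd ξ * (w.deriv ξ / w ξ) := by
  have hd := dense_domain_opA w
  refine ⟨hd, ?_, ?_⟩
  · ext y
    refine ⟨fun hy => ?_, fun hy => ?_⟩
    · exact snd_mem_W12_of_inner_eq (z := (opA w).adjoint ⟨y, hy⟩) fun x =>
        LinearPMap.adjoint_isFormalAdjoint hd ⟨y, hy⟩ x
    · obtain ⟨z, hz0, hz⟩ := exists_adjoint_value hy
      exact LinearPMap.mem_adjoint_domain_of_exists y ⟨z, fun x => inner_opA x hy hz0 hz⟩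
  · intro y hy
    obtain ⟨z, hz0, hz⟩ := exists_adjoint_value hy
    rw [LinearPMap.adjoint_apply_eq hd y fun x => inner_opA x hy hz0 hz]
    exact ⟨hz0, hz⟩
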